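/- Let $\mathbb D=\{z\in\mathbb C:|z|<1\}$. Let $\gamma:\mathrm S^1=\partial\mathbb D\to\mathbb C$ be a continuous, piecewise smooth closed curve whose derivative nowhere vanishes. (Here piecewise smooth means piecewise $C^1$: $[0,2\pi]$ can, up to a shift, be divided into finitely many closed intervals such that $\theta\mapsto\gamma(e^{i\theta})$ is $C^1$ with non-zero derivative on each of them, end points included.) Assume that $\gamma$ is generic: it has finitely many self-intersection points, each of these is a double point (it has exactly two preimages under $\gamma$), and at each of them $\gamma$ is differentiable at both preimages with linearly independent tangent vectors. Assume also that $\gamma$ is self-overlapping: it extends to an immersion of the disk, that is, there is a continuous map $F:\overline{\mathbb D}\to\mathbb C=\mathbb R^2$ with $F|_{\partial\mathbb D}=\gamma$ which is $C^1$ with everywhere invertible differential on $\mathbb D$ and is locally injective on all of $\overline{\mathbb D}$, boundary points included. (The last condition holds automatically if $F$ is $C^1$ with invertible differential up to the boundary.) Then the number of self-intersection points of $\gamma$ is even. -/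

import Mathlib

namespace SelfOverlapping

/-- The closed curve `γ` on the unit circle, written as a `2π`-periodic function of the angle. -/
noncomputable def angular (γ : Circle → ℂ) (θ : ℝ) : ℂ := γ (Circle.exp θ)

/-- `γ` is a continuous, piecewise smooth (that is, piecewise `C¹`) closed curve with nowhere
vanishing derivative: a full period splits into finitely many closed intervals, on each of which
`γ` is `C¹` up to the end points with nonzero derivative (one-sided at the end points). -/
structure IsPiecewiseRegular (γ : Circle → ℂ) : Prop where
  continuous : Continuous γ
  pieces : ∃ (n : ℕ) (a : ℕ → ℝ), 0 < n ∧ (∀ i < n, a i < a (i + 1)) ∧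
    a n = a 0 + 2 * Real.pi ∧
    ∀ i < n, ContDiffOn ℝ 1 (angular γ) (Set.Icc (a i) (a (i + 1))) ∧
      ∀ t ∈ Set.Icc (a i) (a (i + 1)),
        derivWithin (angular γ) (Set.Icc (a i) (a (i + 1))) t ≠ 0

/-- The self-intersection points of `γ`: the points of the plane visited at least twice. -/
def selfIntersections (γ : Circle → ℂ) : Set ℂ :=
  {w | ∃ x y : Circle, x ≠ y ∧ γ x = w ∧ γ y = w}

/-- `γ` is generic: it has finitely many self-intersection points, each of them is a double point,
and at each of them the two branches have tangent vectors and cross transversally. -/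
structure IsGeneric (γ : Circle → ℂ) : Prop where
  finite : (selfIntersections γ).Finite
  double : ∀ w ∈ selfIntersections γ, (γ ⁻¹' {w}).ncard = 2
  transverse : ∀ s t : ℝ, Circle.exp s ≠ Circle.exp t → angular γ s = angular γ t →
    DifferentiableAt ℝ (angular γ) s ∧ DifferentiableAt ℝ (angular γ) t ∧
      LinearIndependent ℝ ![deriv (angular γ) s, deriv (angular γ) t]

/-- `F` is an immersion of the closed unit disk into the plane: it is continuous on the closed
disk, `C¹` with injective differential on the open disk, and locally injective up to the boundary.
At boundary points local injectivity replaces injectivity of the differential, so that the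
boundary curve may have corners; a map that is `C¹` with injective differential up to the boundary
is locally injective. -/
structure IsDiskImmersion (F : ℂ → ℂ) : Prop where
  continuousOn : ContinuousOn F (Metric.closedBall 0 1)
  contDiffOn : ContDiffOn ℝ 1 F (Metric.ball 0 1)
  injective_fderiv : ∀ z ∈ Metric.ball (0 : ℂ) 1, Function.Injective (fderiv ℝ F z)
  locally_injOn : ∀ z ∈ Metric.closedBall (0 : ℂ) 1,
    ∃ U ∈ nhds z, Set.InjOn F (U ∩ Metric.closedBall 0 1)

/-- `γ` is self-overlapping: it extends to an immersion of the disk into the plane. -/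
def IsSelfOverlapping (γ : Circle → ℂ) : Prop :=
  ∃ F : ℂ → ℂ, IsDiskImmersion F ∧ ∀ z : Circle, F z = γ z

end SelfOverlapping

/-!
Unordered pairs of distinct points of the circle form a Möbius band, whose universal cover is the
strip of pairs of angles `(s, t)` with `s < t < s + 2π`. The chord function `γ(eⁱᵗ) - γ(eⁱˢ)` lives
on this strip; it changes sign under the deck generator `(s, t) ↦ (t, s + 2π)`, and up to the deck
group its zeros are the crossings of `γ`. A nowhere vanishing function on the strip which the
generator multiplies by `η = ±1` has a continuous square root, because the strip is contractible,
and applying the generator twice shows that this root is multiplied by `η` along each line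
`t = s + ε`. So `η` is the parity of the winding number of `s ↦ U(s, s + ε)`.

The parity of the winding number of short chords is now computed twice. If `γ` bounds a locally
injective map `F` of the disk, then, by compactness, there is `δ > 0` such that `F` separates
distinct points at distance at most `δ`. Pushing both points of a pair radially inwards until their
distance is at most `δ` makes the chord function nowhere vanishing without changing it on short
chords, so that `η = -1`. Alternatively, one divides the chord function by one explicit factor for
each of the `n` crossings. Each factor is odd under the generator and has winding number zero on
short chords, so the quotient, and with it the chord function on short chords, has
`η = (-1) ^ (n + 1)`. Hence `n` is even.
-/

namespace SelfOverlapping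

open Filter Topology Complex
open scoped Real

/-- A nowhere vanishing loop `f` of period `2π` has square root monodromy `η` if a continuous square
root of `f` is multiplied by `η` after one period. This encodes the parity of the winding number `n`
of `f` around the origin, since `η = (-1) ^ n`. -/
def HasSqrtMonodromy (f : ℝ → ℂ) (η : ℂ) : Prop :=
  ∃ h : ℝ → ℂ, Continuous h ∧ ∀ s, h s ≠ 0 ∧ h s ^ 2 = f s ∧ h (s + 2 * π) = η * h s

namespace HasSqrtMonodromy

variable {f g : ℝ → ℂ} {η ζ : ℂ}

theorem unique (hη : HasSqrtMonodromy f η) (hζ : HasSqrtMonodromy f ζ) : η = ζ := by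
  obtain ⟨h, hh, h_spec⟩ := hη
  obtain ⟨k, hk, k_spec⟩ := hζ
  have hsq : Set.EqOn (h ^ 2) (k ^ 2) Set.univ := fun s _ =>
    (h_spec s).2.1.trans (k_spec s).2.1.symm
  refine mul_right_cancel₀ (h_spec 0).1 ((h_spec 0).2.2.symm.trans ?_)
  rcases isPreconnected_univ.eq_or_eq_neg_of_sq_eq hh.continuousOn hk.continuousOn hsq
    fun {s} _ => (k_spec s).1 with heq | heq
  · rw [heq trivial, heq trivial, (k_spec 0).2.2]
  · rw [heq trivial, heq trivial, Pi.neg_apply, Pi.neg_apply, (k_spec 0).2.2, mul_neg]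

theorem mul (hf : HasSqrtMonodromy f η) (hg : HasSqrtMonodromy g ζ) :
    HasSqrtMonodromy (fun s => f s * g s) (η * ζ) := by
  obtain ⟨h, hh, h_spec⟩ := hf
  obtain ⟨k, hk, k_spec⟩ := hg
  refine ⟨fun s => h s * k s, hh.mul hk, fun s => ⟨mul_ne_zero (h_spec s).1 (k_spec s).1, ?_, ?_⟩⟩
  · rw [mul_pow, (h_spec s).2.1, (k_spec s).2.1]
  · simp only [(h_spec s).2.2, (k_spec s).2.2, mul_mul_mul_comm]

theorem prod {ι : Type*} {S : Finset ι} {f : ι → ℝ → ℂ} {η : ι → ℂ}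
    (h : ∀ i ∈ S, HasSqrtMonodromy (f i) (η i)) :
    HasSqrtMonodromy (fun s => ∏ i ∈ S, f i s) (∏ i ∈ S, η i) := by
  classical
  induction S using Finset.induction_on with
  | empty => exact ⟨fun _ => 1, continuous_const, fun s => by simp⟩
  | insert i S hi ih =>
    simp only [Finset.prod_insert hi]
    exact (h i (Finset.mem_insert_self i S)).mul
      (ih fun j hj => h j (Finset.mem_insert_of_mem hj))

theorem of_mem_slitPlane (hf : Continuous f) (hper : Function.Periodic f (2 * π))
    (hslit : ∀ s, f s ∈ slitPlane) : HasSqrtMonodromy f 1 := by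
  refine ⟨fun s => exp (log (f s) / 2), ((hf.clog hslit).div_const 2).cexp,
    fun s => ⟨exp_ne_zero _, ?_, by simp only [hper s, one_mul]⟩⟩
  rw [← exp_nat_mul, Nat.cast_ofNat, mul_div_cancel₀ _ two_ne_zero,
    exp_log (slitPlane_ne_zero (hslit s))]

end HasSqrtMonodromy

theorem apply_apply_eq_sq_mul_of_sq_eq {X : Type*} [TopologicalSpace X] {S : Set X}
    (hS : IsPreconnected S) {T : X → X} (hT : ContinuousOn T S) (hTS : Set.MapsTo T S S)
    {h : X → ℂ} (hh : ContinuousOn h S) (h0 : ∀ x ∈ S, h x ≠ 0) {c : ℂ}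
    (hsq : ∀ x ∈ S, (c * h x) ^ 2 = h (T x) ^ 2) {x : X} (hx : x ∈ S) :
    h (T (T x)) = c ^ 2 * h x := by
  rcases hS.eq_or_eq_neg_of_sq_eq (hh.const_mul c) (hh.comp hT hTS) hsq
    fun hx => h0 _ (hTS hx) with heq | heq
  all_goals
    have h1 := heq hx
    have h2 := heq (hTS hx)
    simp only [Pi.neg_apply, Function.comp_apply] at h1 h2
  · linear_combination -h2 - c * h1
  · linear_combination h2 - c * h1

theorem exists_continuousOn_sq_eq {E : Type*} [NormedAddCommGroup E] [NormedSpace ℝ E] {S : Set E}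
    (hS : Convex ℝ S) (hne : S.Nonempty) (hopen : IsOpen S) {f : E → ℂ} (hf : ContinuousOn f S)
    (h0 : ∀ x ∈ S, f x ≠ 0) : ∃ h : E → ℂ, ContinuousOn h S ∧ ∀ x, h x ^ 2 = f x := by
  have : ContractibleSpace S := hS.contractibleSpace hne
  have hsc : IsSimplyConnected S := SimplyConnectedSpace.ofContractible S
  exact exists_continuousOn_pow_eq hsc hopen hf (by rintro ⟨x, hx, hfx⟩; exact h0 x hx hfx)
    two_ne_zero

theorem tendsto_div_of_hasFDerivAt_smul {𝕜 𝕜' E : Type*} [NontriviallyNormedField 𝕜]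
    [NormedField 𝕜'] [NormedAlgebra 𝕜 𝕜'] [NormedAddCommGroup E] [NormedSpace 𝕜 E]
    {f g : E → 𝕜'} {A : E →L[𝕜] 𝕜'} {P : E} {c : 𝕜'} (hA : IsInducing A)
    (hf : HasFDerivAt f (c • A) P) (hg : HasFDerivAt g A P) (hf0 : f P = 0) (hg0 : g P = 0) :
    Tendsto (fun Q => f Q / g Q) (𝓝[≠] P) (𝓝 c) := by
  have hΘ : g =Θ[𝓝 P] fun Q => Q - P := by simpa only [hg0, sub_zero] using hg.isTheta_sub hA
  have ho : (fun Q => f Q - c * g Q) =o[𝓝 P] g := by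
    refine Asymptotics.IsLittleO.trans_isBigO ?_ hΘ.isBigO_symm
    simpa [hf0, hg0] using (hf.sub (hg.const_mul c)).isLittleO
  have hlim : Tendsto (fun Q => (f Q - c * g Q) / g Q + c) (𝓝[≠] P) (𝓝 c) := by
    simpa only [zero_add] using
      (ho.tendsto_div_nhds_zero.mono_left nhdsWithin_le_nhds).add_const c
  refine hlim.congr' ?_
  filter_upwards [nhdsWithin_le_nhds hΘ.eq_zero_iff, self_mem_nhdsWithin] with Q hQ hQP
  have hgQ : g Q ≠ 0 := mt hQ.1 (sub_ne_zero.2 hQP)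
  field_simp
  ring

theorem exists_continuousOn_eq_mul {X : Type*} [TopologicalSpace X] {S : Set X} {g k : X → ℂ}
    (hg : Continuous g) (hk : Continuous k) (h0 : ∀ P ∈ S, k P = 0 ↔ g P = 0)
    (hlim : ∀ P ∈ S, g P = 0 → ∃ c ≠ 0, Tendsto (fun Q => g Q / k Q) (𝓝[≠] P) (𝓝 c)) :
    ∃ U : X → ℂ, ContinuousOn U S ∧ (∀ P ∈ S, U P ≠ 0) ∧ ∀ P ∈ S, g P = U P * k P := by
  classical
  choose! c hc hlim using hlim
  refine ⟨fun P => if g P = 0 then c P else g P / k P, fun P hP => ?_, fun P hP => ?_,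
    fun P hP => ?_⟩
  · refine ContinuousAt.continuousWithinAt ?_
    by_cases hgP : g P = 0
    · rw [continuousAt_iff_punctured_nhds]
      simp only [hgP, if_true]
      refine (hlim P hP hgP).congr' ?_
      filter_upwards [(hlim P hP hgP).eventually_ne (hc P hP hgP)] with Q hQ
      rw [if_neg (div_ne_zero_iff.1 hQ).1]
    · have hkP : k P ≠ 0 := mt (h0 P hP).1 hgP
      refine (hg.continuousAt.div hk.continuousAt hkP).congr ?_
      filter_upwards [hg.continuousAt.eventually_ne hgP] with Q hQ
      rw [if_neg hQ, Pi.div_apply]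
  · beta_reduce
    split_ifs with h
    · exact hc P hP h
    · exact div_ne_zero h (mt (h0 P hP).1 h)
  · beta_reduce
    split_ifs with h
    · rw [h, (h0 P hP).2 h, mul_zero]
    · rw [div_mul_cancel₀ _ (mt (h0 P hP).1 h)]

theorem exists_pos_forall_eq_of_dist_lt {α β : Type*} [PseudoMetricSpace α] {K : Set α}
    (hK : IsCompact K) {F : α → β} (h : ∀ z ∈ K, ∃ U ∈ 𝓝 z, Set.InjOn F (U ∩ K)) :
    ∃ δ > 0, ∀ p ∈ K, ∀ q ∈ K, dist q p < δ → F p = F q → p = q := by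
  choose! U hU hinj using h
  obtain ⟨V, hV, hVU⟩ := lebesgue_number_lemma_nhds' (U := fun x _ => U x) hK hU
  obtain ⟨δ, hδ, hδV⟩ := Metric.mem_uniformity_dist.1 hV
  refine ⟨δ, hδ, fun p hp q hq hpq hF => ?_⟩
  obtain ⟨y, hy⟩ := hVU p hp
  refine hinj y y.2 ⟨hy ?_, hp⟩ ⟨hy ?_, hq⟩ hF
  · exact hδV (by rwa [dist_self])
  · exact hδV (by rwa [dist_comm])

/-- The pairs of angles `(s, t)` with `s < t < s + 2π`. This strip is the universal cover of the
Möbius band of unordered pairs of distinct points of the circle. -/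
def strip : Set (ℝ × ℝ) := {P | P.2 - P.1 ∈ Set.Ioo 0 (2 * π)}

/-- The generator `(s, t) ↦ (t, s + 2π)` of the deck group of the strip over the Möbius band. -/
noncomputable def swapAngles (P : ℝ × ℝ) : ℝ × ℝ := (P.2, P.1 + 2 * π)

/-- The unordered pair of points of the circle with the given angles. -/
noncomputable def endpoints (P : ℝ × ℝ) : Sym2 Circle := s(Circle.exp P.1, Circle.exp P.2)

theorem isOpen_strip : IsOpen strip := isOpen_Ioo.preimage (by fun_prop)

theorem convex_strip : Convex ℝ strip :=
  (convex_Ioo 0 (2 * π)).linear_preimage (LinearMap.snd ℝ ℝ ℝ - LinearMap.fst ℝ ℝ ℝ)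

theorem diagonal_mem_strip {ε : ℝ} (hε : ε ∈ Set.Ioo 0 (2 * π)) (s : ℝ) : (s, s + ε) ∈ strip := by
  simpa only [strip, Set.mem_ofPred_eq, add_sub_cancel_left] using hε

theorem mapsTo_swapAngles_strip : Set.MapsTo swapAngles strip strip := by
  rintro P ⟨h1, h2⟩
  constructor <;> simp only [swapAngles] <;> linarith

theorem continuous_swapAngles : Continuous swapAngles := by
  unfold swapAngles
  fun_prop

theorem circle_exp_ne_of_mem_strip {P : ℝ × ℝ} (hP : P ∈ strip) :
    Circle.exp P.1 ≠ Circle.exp P.2 := by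
  obtain ⟨h1, h2⟩ := hP
  intro h
  have heq : P.1 = P.2 := Circle.exp_injOn_Ico (a := P.1) (b := P.1 + 2 * π) (by linarith)
    ⟨le_rfl, by linarith⟩ ⟨by linarith, by linarith⟩ h
  linarith

theorem surjOn_endpoints_strip : Set.SurjOn endpoints strip {e | ¬e.IsDiag} := by
  intro e he
  induction e using Sym2.ind with | h x y
  rw [Set.mem_ofPred_eq, Sym2.mk_isDiag_iff] at he
  refine ⟨(arg x, x.angleDiff y + arg x), ?_, ?_⟩
  · simpa only [strip, Set.mem_ofPred_eq, add_sub_cancel_right] using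
      ⟨Circle.angleDiff_pos he, Circle.angleDiff_lt_two_pi x y⟩
  · rw [endpoints, Circle.exp_add, Circle.exp_arg, Circle.exp_angleDiff_mul]

theorem exists_eq_add_int_mul_of_circle_exp_eq {P Q : ℝ × ℝ} (hP : P ∈ strip) (hQ : Q ∈ strip)
    (h1 : Circle.exp Q.1 = Circle.exp P.1) (h2 : Circle.exp Q.2 = Circle.exp P.2) :
    ∃ k : ℤ, Q = (P.1 + k * (2 * π), P.2 + k * (2 * π)) := by
  obtain ⟨k, hk⟩ := Circle.exp_eq_exp.1 h1
  obtain ⟨l, hl⟩ := Circle.exp_eq_exp.1 h2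
  have hgap : |(l - k : ℝ) * (2 * π)| < 1 * (2 * π) := by
    rw [abs_lt]
    constructor <;> linarith [hP.1, hP.2, hQ.1, hQ.2]
  rw [abs_mul, abs_of_pos Real.two_pi_pos, mul_lt_mul_iff_of_pos_right Real.two_pi_pos] at hgap
  have hlk : l - k = 0 := Int.abs_lt_one_iff.1 (by exact_mod_cast hgap)
  rw [sub_eq_zero.1 hlk] at hl
  exact ⟨k, Prod.ext hk hl⟩

theorem exists_eq_add_int_mul_of_endpoints_eq {P Q : ℝ × ℝ} (hP : P ∈ strip) (hQ : Q ∈ strip)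
    (h : endpoints Q = endpoints P) :
    ∃ R, (R = P ∨ R = swapAngles P) ∧ ∃ k : ℤ, Q = (R.1 + k * (2 * π), R.2 + k * (2 * π)) := by
  rcases Sym2.eq_iff.1 h with ⟨h1, h2⟩ | ⟨h1, h2⟩
  · exact ⟨P, .inl rfl, exists_eq_add_int_mul_of_circle_exp_eq hP hQ h1 h2⟩
  · refine ⟨swapAngles P, .inr rfl,
      exists_eq_add_int_mul_of_circle_exp_eq (mapsTo_swapAngles_strip hP) hQ h1 ?_⟩
    rw [h2, swapAngles, Circle.exp_add_two_pi]

theorem eq_of_endpoints_eq {α : Type*} {f : ℝ × ℝ → α} (hf : ∀ P, f (swapAngles P) = f P)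
    {P Q : ℝ × ℝ} (hP : P ∈ strip) (hQ : Q ∈ strip) (h : endpoints Q = endpoints P) :
    f Q = f P := by
  obtain ⟨R, hR, k, rfl⟩ := exists_eq_add_int_mul_of_endpoints_eq hP hQ h
  have hper : Function.Periodic (fun x => f (R.1 + x, R.2 + x)) (2 * π) := fun x => by
    simpa only [swapAngles, add_assoc] using
      (hf (swapAngles (R.1 + x, R.2 + x))).trans (hf (R.1 + x, R.2 + x))
  have hQR : f (R.1 + k * (2 * π), R.2 + k * (2 * π)) = f R := by
    simpa only [add_zero] using hper.int_mul_eq k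
  rcases hR with rfl | rfl
  · exact hQR
  · exact hQR.trans (hf P)

theorem apply_swapAngles_eq_mul {U K : ℝ × ℝ → ℂ} {η ζ : ℂ} (hU : ContinuousOn U strip)
    (hK0 : ∀ P ∈ strip, ∀ᶠ Q in 𝓝[≠] P, K Q ≠ 0) (hη : η ≠ 0)
    (hK : ∀ P ∈ strip, K (swapAngles P) = η * K P)
    (hUK : ∀ P ∈ strip, U (swapAngles P) * K (swapAngles P) = ζ * η * (U P * K P)) :
    ∀ P ∈ strip, U (swapAngles P) = ζ * U P := by
  intro P hP
  -- The factor `K` can be cancelled off its isolated zeros, and continuity of `U` covers the zeros.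
  have hnhds := isOpen_strip.mem_nhds hP
  have hUswap := hU.comp continuous_swapAngles.continuousOn mapsTo_swapAngles_strip
  refine tendsto_nhds_unique_of_eventuallyEq (l := 𝓝[≠] P)
    ((hUswap.continuousAt hnhds).mono_left nhdsWithin_le_nhds)
    (((hU.continuousAt hnhds).const_mul ζ).mono_left nhdsWithin_le_nhds) ?_
  filter_upwards [nhdsWithin_le_nhds hnhds, hK0 P hP] with Q hQ hQ0
  refine mul_right_cancel₀ (mul_ne_zero hη hQ0) ?_
  rw [Function.comp_apply, ← hK Q hQ, hUK Q hQ, hK Q hQ]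
  ring

theorem hasSqrtMonodromy_diagonal {U : ℝ × ℝ → ℂ} (hU : ContinuousOn U strip)
    (h0 : ∀ P ∈ strip, U P ≠ 0) {η : ℂ} (hη : ∀ P ∈ strip, U (swapAngles P) = η * U P)
    {ε : ℝ} (hε : ε ∈ Set.Ioo 0 (2 * π)) : HasSqrtMonodromy (fun s => U (s, s + ε)) η := by
  have hmem := diagonal_mem_strip hε
  obtain ⟨h, hh, hsq⟩ := exists_continuousOn_sq_eq convex_strip ⟨_, hmem 0⟩ isOpen_strip hU h0
  have hh0 : ∀ P ∈ strip, h P ≠ 0 := fun P hP hP0 =>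
    h0 P hP (by rw [← hsq, hP0, zero_pow two_ne_zero])
  obtain ⟨c, rfl⟩ := IsAlgClosed.exists_pow_nat_eq η two_pos
  have hswap : ∀ P ∈ strip, h (swapAngles (swapAngles P)) = c ^ 2 * h P := fun P =>
    apply_apply_eq_sq_mul_of_sq_eq convex_strip.isPreconnected continuous_swapAngles.continuousOn
      mapsTo_swapAngles_strip hh hh0 fun P hP => by rw [mul_pow, hsq, hsq, hη P hP]
  refine ⟨fun s => h (s, s + ε), hh.comp_continuous (by fun_prop) hmem, fun s =>
    ⟨hh0 _ (hmem s), hsq _, ?_⟩⟩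
  rw [← hswap _ (hmem s)]
  simp only [swapAngles, add_right_comm]

/-- Half the length of the arc from `P.1` to `P.2`. -/
noncomputable def halfGap (P : ℝ × ℝ) : ℝ := (P.2 - P.1) / 2

/-- The midpoint of the arc from `P.1` to `P.2`. -/
noncomputable def midAngle (P : ℝ × ℝ) : ℝ := (P.1 + P.2) / 2

theorem halfGap_swapAngles (P : ℝ × ℝ) : halfGap (swapAngles P) = π - halfGap P := by
  simp only [halfGap, swapAngles]
  ring

theorem midAngle_swapAngles (P : ℝ × ℝ) : midAngle (swapAngles P) = midAngle P + π := by
  simp only [midAngle, swapAngles]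
  ring

theorem hasFDerivAt_halfGap {P : ℝ × ℝ} : HasFDerivAt halfGap
    ((2 : ℝ)⁻¹ • (ContinuousLinearMap.snd ℝ ℝ ℝ - ContinuousLinearMap.fst ℝ ℝ ℝ)) P :=
  (ContinuousLinearMap.hasFDerivAt _).congr_of_eventuallyEq <|
    .of_forall fun Q => by simp [halfGap, div_eq_inv_mul]

theorem hasFDerivAt_midAngle {P : ℝ × ℝ} : HasFDerivAt midAngle
    ((2 : ℝ)⁻¹ • (ContinuousLinearMap.fst ℝ ℝ ℝ + ContinuousLinearMap.snd ℝ ℝ ℝ)) P :=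
  (ContinuousLinearMap.hasFDerivAt _).congr_of_eventuallyEq <|
    .of_forall fun Q => by simp [midAngle, div_eq_inv_mul, mul_add]

theorem halfGap_mem_Ioo {P : ℝ × ℝ} (hP : P ∈ strip) : halfGap P ∈ Set.Ioo 0 π := by
  obtain ⟨h1, h2⟩ := hP
  constructor <;> simp only [halfGap] <;> linarith

theorem sin_halfGap_pos {P : ℝ × ℝ} (hP : P ∈ strip) : 0 < Real.sin (halfGap P) :=
  Real.sin_pos_of_mem_Ioo (halfGap_mem_Ioo hP)

theorem abs_cos_halfGap_lt_one {P : ℝ × ℝ} (hP : P ∈ strip) : |Real.cos (halfGap P)| < 1 := by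
  rw [← sq_lt_one_iff_abs_lt_one, Real.cos_sq']
  linarith [pow_pos (sin_halfGap_pos hP) 2]

/-- The differential at `(s, t)` of the chord function `(s, t) ↦ α t - α s` of a curve `α` with
tangent vectors `v` at `s` and `w` at `t`. -/
noncomputable def chordFDeriv (v w : ℂ) : ℝ × ℝ →L[ℝ] ℂ :=
  (ContinuousLinearMap.snd ℝ ℝ ℝ).smulRight w - (ContinuousLinearMap.fst ℝ ℝ ℝ).smulRight v

theorem chordFDeriv_apply (v w : ℂ) (x : ℝ × ℝ) : chordFDeriv v w x = x.2 • w - x.1 • v := rfl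

theorem chordFDeriv_injective {v w : ℂ} (h : LinearIndependent ℝ ![v, w]) :
    Function.Injective (chordFDeriv v w) := by
  refine (injective_iff_map_eq_zero _).2 fun x hx => ?_
  obtain ⟨h1, h2⟩ := LinearIndependent.pair_iff.1 h (-x.1) x.2 (by
    rw [neg_smul, neg_add_eq_sub, ← chordFDeriv_apply, hx])
  exact Prod.ext (neg_eq_zero.1 h1) h2

/-- The model of the chord function near a transverse double point with angles `P`. Like the chord
function it is odd under `swapAngles`. For non-real `τ` it vanishes on the strip exactly at the
pairs with the same endpoints as `P`: the imaginary part forces the mid-angles to agree modulo `π`,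
and the real part then fixes the gap. -/
noncomputable def crossingModel (τ : ℂ) (P Q : ℝ × ℝ) : ℂ :=
  ((Real.cos (halfGap Q) - Real.cos (halfGap P) * Real.cos (midAngle Q - midAngle P) : ℝ) : ℂ) +
    τ * ((Real.sin (halfGap P) * Real.sin (midAngle Q - midAngle P) : ℝ) : ℂ)

section crossingModel

variable {τ : ℂ} {P Q : ℝ × ℝ}

theorem continuous_crossingModel : Continuous (crossingModel τ P) := by
  unfold crossingModel halfGap midAngle
  fun_prop

theorem crossingModel_swapAngles : crossingModel τ P (swapAngles Q) = -crossingModel τ P Q := by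
  unfold crossingModel
  rw [halfGap_swapAngles, midAngle_swapAngles, add_sub_right_comm, Real.cos_pi_sub, Real.cos_add_pi,
    Real.sin_add_pi]
  push_cast
  ring

theorem crossingModel_neg_swapAngles_left :
    crossingModel (-τ) (swapAngles P) Q = crossingModel τ P Q := by
  unfold crossingModel
  rw [halfGap_swapAngles, midAngle_swapAngles, ← sub_sub, Real.cos_pi_sub, Real.sin_pi_sub,
    Real.cos_sub_pi, Real.sin_sub_pi]
  push_cast
  ring

theorem crossingModel_self : crossingModel τ P P = 0 := by
  simp [crossingModel]

theorem crossingModel_re : (crossingModel τ P Q).re =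
    Real.cos (halfGap Q) - Real.cos (halfGap P) * Real.cos (midAngle Q - midAngle P) +
      τ.re * (Real.sin (halfGap P) * Real.sin (midAngle Q - midAngle P)) := by
  rw [crossingModel, add_re, ofReal_re, re_mul_ofReal]

theorem crossingModel_im : (crossingModel τ P Q).im =
    τ.im * (Real.sin (halfGap P) * Real.sin (midAngle Q - midAngle P)) := by
  rw [crossingModel, add_im, ofReal_im, im_mul_ofReal, zero_add]

theorem endpoints_eq_of_crossingModel_eq_zero (hτ : τ.im ≠ 0) (hP : P ∈ strip) (hQ : Q ∈ strip)
    (h : crossingModel τ P Q = 0) : endpoints Q = endpoints P := by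
  have hνP := Set.Ioo_subset_Icc_self (halfGap_mem_Ioo hP)
  have hνQ := Set.Ioo_subset_Icc_self (halfGap_mem_Ioo hQ)
  have hsin : Real.sin (midAngle Q - midAngle P) = 0 := by
    simpa [h, hτ, (sin_halfGap_pos hP).ne'] using crossingModel_im (τ := τ) (P := P) (Q := Q)
  have hcos : Real.cos (halfGap Q) = Real.cos (halfGap P) * Real.cos (midAngle Q - midAngle P) := by
    simpa [h, hsin, eq_comm (a := (0 : ℝ)), sub_eq_zero] using
      crossingModel_re (τ := τ) (P := P) (Q := Q)
  obtain ⟨n, hn⟩ := Real.sin_eq_zero_iff.1 hsin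
  rw [← hn] at hcos
  rcases Int.even_or_odd' n with ⟨k, rfl | rfl⟩
  · have hk : ((2 * k : ℤ) : ℝ) * π = k * (2 * π) := by push_cast; ring
    rw [hk] at hn hcos
    rw [Real.cos_int_mul_two_pi, mul_one] at hcos
    have hν := Real.injOn_cos hνQ hνP hcos
    simp only [midAngle, halfGap] at hn hν
    exact Sym2.eq_iff.2 <| .inl
      ⟨Circle.exp_eq_exp.2 ⟨k, by linarith⟩, Circle.exp_eq_exp.2 ⟨k, by linarith⟩⟩
  · have hk : ((2 * k + 1 : ℤ) : ℝ) * π = k * (2 * π) + π := by push_cast; ring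
    rw [hk] at hn hcos
    rw [Real.cos_add_pi, Real.cos_int_mul_two_pi, mul_neg_one, ← Real.cos_pi_sub] at hcos
    have hν := Real.injOn_cos hνQ ⟨by linarith [hνP.2], by linarith [hνP.1]⟩ hcos
    simp only [midAngle, halfGap] at hn hν
    refine Sym2.eq_iff.2 <| .inr
      ⟨Circle.exp_eq_exp.2 ⟨k, by linarith⟩, Circle.exp_eq_exp.2 ⟨k + 1, ?_⟩⟩
    push_cast
    linarith

theorem crossingModel_mem_slitPlane (hτ : τ.im ≠ 0) (hP : P ∈ strip)
    (hcos : |Real.cos (halfGap P)| < Real.cos (halfGap Q)) : crossingModel τ P Q ∈ slitPlane := by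
  rw [mem_slitPlane_iff, crossingModel_im, crossingModel_re]
  by_cases hsin : Real.sin (midAngle Q - midAngle P) = 0
  · left
    rw [hsin, mul_zero, mul_zero, add_zero, sub_pos]
    calc Real.cos (halfGap P) * Real.cos (midAngle Q - midAngle P)
        ≤ |Real.cos (halfGap P)| * |Real.cos (midAngle Q - midAngle P)| := by
          rw [← abs_mul]
          exact le_abs_self _
      _ ≤ |Real.cos (halfGap P)| := mul_le_of_le_one_right (abs_nonneg _) (Real.abs_cos_le_one _)
      _ < Real.cos (halfGap Q) := hcos
  · exact .inr (mul_ne_zero hτ (mul_ne_zero (sin_halfGap_pos hP).ne' hsin))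

theorem eventually_hasSqrtMonodromy_crossingModel (hτ : τ.im ≠ 0) (hP : P ∈ strip) :
    ∀ᶠ ε in 𝓝[>] 0, HasSqrtMonodromy (fun s => crossingModel τ P (s, s + ε)) 1 := by
  have hcos : ∀ᶠ ε : ℝ in 𝓝 0, |Real.cos (halfGap P)| < Real.cos (ε / 2) :=
    ((by fun_prop : Continuous fun ε : ℝ => Real.cos (ε / 2)).tendsto 0).eventually_const_lt
      (by simpa using abs_cos_halfGap_lt_one hP)
  filter_upwards [nhdsWithin_le_nhds hcos] with ε hε
  refine .of_mem_slitPlane (continuous_crossingModel.comp (by fun_prop)) (fun s => ?_) fun s =>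
    crossingModel_mem_slitPlane hτ hP (by simpa only [halfGap, add_sub_cancel_left] using hε)
  have hswap : (s + 2 * π, s + 2 * π + ε) = swapAngles (swapAngles (s, s + ε)) := by
    simp only [swapAngles, add_right_comm]
  rw [hswap, crossingModel_swapAngles, crossingModel_swapAngles, neg_neg]

theorem hasFDerivAt_crossingModel_self {v w : ℂ} (hvw : v + w ≠ 0) :
    HasFDerivAt (crossingModel ((v - w) / (v + w)) P)
      ((-Real.sin (halfGap P) / (v + w) : ℂ) • chordFDeriv v w) P := by
  have hμ := (hasFDerivAt_midAngle (P := P)).sub_const (midAngle P)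
  have hre := hasFDerivAt_halfGap.cos.sub (hμ.cos.const_mul (Real.cos (halfGap P)))
  have him := hμ.sin.const_mul (Real.sin (halfGap P))
  refine ((ofRealCLM.hasFDerivAt.comp P hre).add
    ((ofRealCLM.hasFDerivAt.comp P him).const_mul ((v - w) / (v + w)))).congr_fderiv ?_
  refine ContinuousLinearMap.ext fun x => ?_
  simp only [sub_self, Real.sin_zero, Real.cos_zero, neg_zero, zero_smul, smul_zero, sub_zero,
    one_smul, ContinuousLinearMap.comp_apply, add_apply, sub_apply, _root_.smul_apply,
    chordFDeriv_apply, ContinuousLinearMap.coe_fst', ContinuousLinearMap.coe_snd',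
    ofRealCLM_apply, smul_eq_mul, real_smul]
  push_cast
  field_simp
  ring

end crossingModel

/-- The chord function of `γ`. Its zeros in the strip are the pairs of angles of the crossings. -/
noncomputable def chord (γ : Circle → ℂ) (P : ℝ × ℝ) : ℂ := angular γ P.2 - angular γ P.1

/-- The crossings of `γ`: the unordered pairs of distinct parameters with the same image. -/
def crossings (γ : Circle → ℂ) : Set (Sym2 Circle) := {e | ¬e.IsDiag ∧ (e.map γ).IsDiag}

/-- The two branches of `γ` at the angles `P.1` and `P.2` have linearly independent tangent
vectors. -/
structure IsTransverseAt (γ : Circle → ℂ) (P : ℝ × ℝ) : Prop where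
  differentiableAt_fst : DifferentiableAt ℝ (angular γ) P.1
  differentiableAt_snd : DifferentiableAt ℝ (angular γ) P.2
  linearIndependent : LinearIndependent ℝ ![deriv (angular γ) P.1, deriv (angular γ) P.2]

/-- At every crossing of `γ` the two branches are transverse. -/
def HasTransverseCrossings (γ : Circle → ℂ) : Prop :=
  ∀ P, endpoints P ∈ crossings γ → IsTransverseAt γ P

/-- The parameter `τ` for which `crossingModel τ P` agrees with the chord function at `P` to first
order, up to a nonzero factor, when the two branches of `γ` are transverse at `P`. -/
noncomputable def tangentRatio (γ : Circle → ℂ) (P : ℝ × ℝ) : ℂ :=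
  (deriv (angular γ) P.1 - deriv (angular γ) P.2) / (deriv (angular γ) P.1 + deriv (angular γ) P.2)

theorem add_ne_zero_of_linearIndependent {v w : ℂ} (h : LinearIndependent ℝ ![v, w]) :
    v + w ≠ 0 := fun hvw => by
  simpa using (LinearIndependent.pair_iff.1 h 1 1 (by simpa using hvw)).1

theorem im_sub_div_add_ne_zero_of_linearIndependent {v w : ℂ} (h : LinearIndependent ℝ ![v, w]) :
    ((v - w) / (v + w)).im ≠ 0 := by
  intro him
  obtain ⟨r, hr⟩ : ∃ r : ℝ, (v - w) / (v + w) = r :=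
    ⟨_, (conj_eq_iff_re.1 (conj_eq_iff_im.2 him)).symm⟩
  rw [div_eq_iff (add_ne_zero_of_linearIndependent h)] at hr
  obtain ⟨h1, h2⟩ := LinearIndependent.pair_iff.1 h (1 - r) (-1 - r) (by
    simp only [real_smul]
    push_cast
    linear_combination hr)
  linarith

section chord

variable {γ : Circle → ℂ} {P Q : ℝ × ℝ}

theorem periodic_angular (γ : Circle → ℂ) : Function.Periodic (angular γ) (2 * π) := fun θ =>
  congrArg γ (Circle.periodic_exp θ)

theorem deriv_angular_add_two_pi (γ : Circle → ℂ) (θ : ℝ) :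
    deriv (angular γ) (θ + 2 * π) = deriv (angular γ) θ := by
  rw [← deriv_comp_add_const, (periodic_angular γ).funext]

theorem continuous_angular (hγ : Continuous γ) : Continuous (angular γ) :=
  hγ.comp Circle.exp.continuous

theorem continuous_chord (hγ : Continuous γ) : Continuous (chord γ) :=
  ((continuous_angular hγ).comp continuous_snd).sub ((continuous_angular hγ).comp continuous_fst)

theorem chord_swapAngles : chord γ (swapAngles P) = -chord γ P := by
  rw [chord, chord, swapAngles, periodic_angular γ, neg_sub]

theorem chord_eq_zero_iff (hP : P ∈ strip) : chord γ P = 0 ↔ endpoints P ∈ crossings γ := by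
  rw [chord, sub_eq_zero, crossings, endpoints, Set.mem_ofPred_eq, Sym2.mk_isDiag_iff, Sym2.map_mk,
    Sym2.mk_isDiag_iff, and_iff_right (circle_exp_ne_of_mem_strip hP), eq_comm]
  rfl

theorem tangentRatio_swapAngles : tangentRatio γ (swapAngles P) = -tangentRatio γ P := by
  rw [tangentRatio, tangentRatio, ← neg_div, neg_sub, swapAngles, deriv_angular_add_two_pi,
    add_comm (deriv _ P.1)]

theorem IsTransverseAt.tangentRatio_im_ne_zero (h : IsTransverseAt γ P) :
    (tangentRatio γ P).im ≠ 0 :=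
  im_sub_div_add_ne_zero_of_linearIndependent h.linearIndependent

theorem IsTransverseAt.hasFDerivAt_chord (h : IsTransverseAt γ P) :
    HasFDerivAt (chord γ) (chordFDeriv (deriv (angular γ) P.1) (deriv (angular γ) P.2)) P := by
  have h1 := h.differentiableAt_fst.hasDerivAt.hasFDerivAt.comp P (hasFDerivAt_fst (𝕜 := ℝ))
  have h2 := h.differentiableAt_snd.hasDerivAt.hasFDerivAt.comp P (hasFDerivAt_snd (𝕜 := ℝ))
  exact (h2.sub h1).congr_fderiv (ContinuousLinearMap.ext fun x => by simp [chordFDeriv_apply])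

/-- The crossing model adapted to the branches of `γ` at `P`. It depends only on the endpoints of
`P` and accounts for the zeros of the chord function at the crossing with these endpoints. -/
noncomputable def crossingFactor (γ : Circle → ℂ) (P : ℝ × ℝ) : ℝ × ℝ → ℂ :=
  crossingModel (tangentRatio γ P) P

theorem crossingFactor_swapAngles : crossingFactor γ (swapAngles P) = crossingFactor γ P := by
  ext Q
  rw [crossingFactor, crossingFactor, tangentRatio_swapAngles, crossingModel_neg_swapAngles_left]

theorem crossingFactor_congr (hP : P ∈ strip) (hQ : Q ∈ strip) (h : endpoints Q = endpoints P) :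
    crossingFactor γ Q = crossingFactor γ P :=
  eq_of_endpoints_eq (fun _ => crossingFactor_swapAngles) hP hQ h

theorem IsTransverseAt.crossingFactor_eq_zero_iff (h : IsTransverseAt γ P) (hP : P ∈ strip)
    (hQ : Q ∈ strip) : crossingFactor γ P Q = 0 ↔ endpoints Q = endpoints P := by
  refine ⟨endpoints_eq_of_crossingModel_eq_zero h.tangentRatio_im_ne_zero hP hQ, fun heq => ?_⟩
  rw [← crossingFactor_congr hP hQ heq]
  exact crossingModel_self

theorem IsTransverseAt.tendsto_chord_div_crossingFactor (h : IsTransverseAt γ P) (hP : P ∈ strip)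
    (h0 : chord γ P = 0) :
    ∃ c ≠ 0, Tendsto (fun Q => chord γ Q / crossingFactor γ P Q) (𝓝[≠] P) (𝓝 c) := by
  have hsum := add_ne_zero_of_linearIndependent h.linearIndependent
  have hr : -Real.sin (halfGap P) / (deriv (angular γ) P.1 + deriv (angular γ) P.2) ≠ 0 :=
    div_ne_zero (neg_ne_zero.2 (ofReal_ne_zero.2 (sin_halfGap_pos hP).ne')) hsum
  have hA := LinearMap.isClosedEmbedding_of_injective
    (LinearMap.ker_eq_bot.2 (chordFDeriv_injective h.linearIndependent))
  have hlim := tendsto_div_of_hasFDerivAt_smul hA.isInducing (hasFDerivAt_crossingModel_self hsum)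
    h.hasFDerivAt_chord crossingModel_self h0
  exact ⟨_, inv_ne_zero hr, (hlim.inv₀ hr).congr fun Q => inv_div _ _⟩

end chord

section crossingProduct

variable {γ : Circle → ℂ} {S : Finset (ℝ × ℝ)} {P : ℝ × ℝ}

/-- The product of the crossing factors at the pairs of angles in `S`. When `S` represents every
crossing once, it carries all the zeros of the chord function in the strip. -/
noncomputable def crossingProduct (γ : Circle → ℂ) (S : Finset (ℝ × ℝ)) (Q : ℝ × ℝ) : ℂ :=
  ∏ P ∈ S, crossingFactor γ P Q

theorem continuous_crossingProduct : Continuous (crossingProduct γ S) :=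
  continuous_finsetProd _ fun _ _ => continuous_crossingModel

theorem crossingProduct_swapAngles :
    crossingProduct γ S (swapAngles P) = (-1) ^ S.card * crossingProduct γ S P := by
  simp only [crossingProduct, crossingFactor, crossingModel_swapAngles, Finset.prod_neg]

/-- A set of pairs of angles in the strip representing every crossing of `γ` exactly once. -/
structure IsCrossingSystem (γ : Circle → ℂ) (S : Finset (ℝ × ℝ)) : Prop where
  subset_strip : ↑S ⊆ strip
  bijOn_endpoints : Set.BijOn endpoints S (crossings γ)

theorem exists_isCrossingSystem (hfin : (crossings γ).Finite) : ∃ S, IsCrossingSystem γ S := by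
  have hsurj : Set.SurjOn endpoints strip (crossings γ) :=
    surjOn_endpoints_strip.mono Set.Subset.rfl fun _ he => he.1
  obtain ⟨S, hS, hbij⟩ := hsurj.exists_bijOn_subset
  lift S to Finset (ℝ × ℝ) using hbij.finite_iff_finite.2 hfin
  exact ⟨S, hS, hbij⟩

namespace IsCrossingSystem

theorem card_eq (h : IsCrossingSystem γ S) : S.card = (crossings γ).ncard := by
  rw [← h.bijOn_endpoints.image_eq, h.bijOn_endpoints.injOn.ncard_image, Set.ncard_coe_finset]

theorem isTransverseAt (h : IsCrossingSystem γ S) (htr : HasTransverseCrossings γ) (hP : P ∈ S) :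
    IsTransverseAt γ P :=
  htr P (h.bijOn_endpoints.mapsTo hP)

theorem crossingProduct_eq_zero_iff (h : IsCrossingSystem γ S) (htr : HasTransverseCrossings γ)
    (hP : P ∈ strip) : crossingProduct γ S P = 0 ↔ chord γ P = 0 := by
  rw [chord_eq_zero_iff hP, ← h.bijOn_endpoints.image_eq, crossingProduct, Finset.prod_eq_zero_iff]
  refine exists_congr fun R => and_congr_right fun hR => ?_
  rw [(h.isTransverseAt htr hR).crossingFactor_eq_zero_iff (h.subset_strip hR) hP, eq_comm]

theorem tendsto_chord_div_crossingProduct (h : IsCrossingSystem γ S)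
    (htr : HasTransverseCrossings γ) (hP : P ∈ strip) (h0 : chord γ P = 0) :
    ∃ c ≠ 0, Tendsto (fun Q => chord γ Q / crossingProduct γ S Q) (𝓝[≠] P) (𝓝 c) := by
  classical
  have hcross := (chord_eq_zero_iff hP).1 h0
  obtain ⟨R, hRS, hRP⟩ := h.bijOn_endpoints.surjOn hcross
  obtain ⟨c, hc, hlim⟩ := (htr P hcross).tendsto_chord_div_crossingFactor hP h0
  rw [← crossingFactor_congr hP (h.subset_strip hRS) hRP] at hlim
  have hrest : crossingProduct γ (S.erase R) P ≠ 0 :=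
    Finset.prod_ne_zero_iff.2 fun T hT hT0 => by
      obtain ⟨hTR, hTS⟩ := Finset.mem_erase.1 hT
      have hPT := ((h.isTransverseAt htr hTS).crossingFactor_eq_zero_iff
        (h.subset_strip hTS) hP).1 hT0
      exact hTR (h.bijOn_endpoints.injOn hTS hRS (hPT.symm.trans hRP.symm))
  have hrest_lim : Tendsto (crossingProduct γ (S.erase R)) (𝓝[≠] P) _ :=
    continuous_crossingProduct.continuousAt.mono_left nhdsWithin_le_nhds
  refine ⟨_, div_ne_zero hc hrest, (hlim.div hrest_lim hrest).congr fun Q => ?_⟩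
  rw [Pi.div_apply, div_div, crossingProduct, crossingProduct,
    Finset.mul_prod_erase S (crossingFactor γ · Q) hRS]

theorem eventually_crossingProduct_ne_zero (h : IsCrossingSystem γ S)
    (htr : HasTransverseCrossings γ) (hP : P ∈ strip) :
    ∀ᶠ Q in 𝓝[≠] P, crossingProduct γ S Q ≠ 0 := by
  by_cases h0 : chord γ P = 0
  · obtain ⟨c, hc, hlim⟩ := h.tendsto_chord_div_crossingProduct htr hP h0
    filter_upwards [hlim.eventually_ne hc] with Q hQ
    exact (div_ne_zero_iff.1 hQ).2
  · exact nhdsWithin_le_nhds (continuous_crossingProduct.continuousAt.eventually_ne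
      (mt (h.crossingProduct_eq_zero_iff htr hP).1 h0))

theorem eventually_hasSqrtMonodromy_crossingProduct (h : IsCrossingSystem γ S)
    (htr : HasTransverseCrossings γ) :
    ∀ᶠ ε in 𝓝[>] 0, HasSqrtMonodromy (fun s => crossingProduct γ S (s, s + ε)) 1 := by
  have hfactor : ∀ᶠ ε in 𝓝[>] 0, ∀ P ∈ S,
      HasSqrtMonodromy (fun s => crossingFactor γ P (s, s + ε)) 1 :=
    (Finset.eventually_all S).2 fun P hP => eventually_hasSqrtMonodromy_crossingModel
      (h.isTransverseAt htr hP).tangentRatio_im_ne_zero (h.subset_strip hP)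
  filter_upwards [hfactor] with ε hε
  simpa only [crossingProduct, Finset.prod_const_one] using HasSqrtMonodromy.prod hε

end IsCrossingSystem

end crossingProduct

theorem eventually_hasSqrtMonodromy_chord_of_hasTransverseCrossings {γ : Circle → ℂ}
    (hγ : Continuous γ) (hfin : (crossings γ).Finite) (htr : HasTransverseCrossings γ) :
    ∀ᶠ ε in 𝓝[>] 0, HasSqrtMonodromy (fun s => chord γ (s, s + ε))
      ((-1) ^ ((crossings γ).ncard + 1)) := by
  obtain ⟨S, hS⟩ := exists_isCrossingSystem hfin
  obtain ⟨U, hU, hU0, hUeq⟩ := exists_continuousOn_eq_mul (continuous_chord hγ)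
    continuous_crossingProduct (fun P hP => hS.crossingProduct_eq_zero_iff htr hP)
    fun P hP => hS.tendsto_chord_div_crossingProduct htr hP
  have hUswap : ∀ P ∈ strip, U (swapAngles P) = (-1) ^ ((crossings γ).ncard + 1) * U P := by
    refine apply_swapAngles_eq_mul hU (fun P => hS.eventually_crossingProduct_ne_zero htr)
      (pow_ne_zero _ (neg_ne_zero.2 one_ne_zero)) (fun _ _ => crossingProduct_swapAngles)
      fun P hP => ?_
    rw [← hUeq P hP, ← hUeq _ (mapsTo_swapAngles_strip hP), chord_swapAngles, hS.card_eq, ← pow_add,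
      Odd.neg_one_pow (by grind), neg_one_mul]
  filter_upwards [hS.eventually_hasSqrtMonodromy_crossingProduct htr,
    Ioo_mem_nhdsGT Real.two_pi_pos] with ε hε hεmem
  have hprod := (hasSqrtMonodromy_diagonal hU hU0 hUswap hεmem).mul hε
  simpa only [mul_one, ← hUeq _ (diagonal_mem_strip hεmem _)] using hprod

section shrunkChord

variable {δ : ℝ} {P : ℝ × ℝ} {F : ℂ → ℂ}

/-- The largest radius at most `1` for which the points of that radius with angles `P.1` and `P.2`
have distance at most `δ`. -/
noncomputable def shrinkRadius (δ : ℝ) (P : ℝ × ℝ) : ℝ :=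
  min 1 (δ / dist (Circle.exp P.1) (Circle.exp P.2))

/-- The chord between the images under `F` of the points with angles `P.1` and `P.2`, pushed
radially inwards to distance at most `δ`. -/
noncomputable def shrunkChord (F : ℂ → ℂ) (δ : ℝ) (P : ℝ × ℝ) : ℂ :=
  F (shrinkRadius δ P * Circle.exp P.2) - F (shrinkRadius δ P * Circle.exp P.1)

theorem dist_circle_exp_pos (hP : P ∈ strip) : 0 < dist (Circle.exp P.1) (Circle.exp P.2) :=
  dist_pos.2 (circle_exp_ne_of_mem_strip hP)

theorem dist_circle_eq_norm_sub (z w : Circle) : dist z w = ‖(z - w : ℂ)‖ :=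
  dist_eq (z : ℂ) w

theorem dist_circle_exp_le (s t : ℝ) : dist (Circle.exp s) (Circle.exp t) ≤ |t - s| := by
  have hfactor : (Circle.exp t : ℂ) - Circle.exp s =
      Circle.exp s * (Complex.exp (I * (t - s : ℝ)) - 1) := by
    rw [mul_comm I, ← Circle.coe_exp, mul_sub, mul_one, ← Circle.coe_mul, ← Circle.exp_add,
      add_sub_cancel]
  rw [dist_comm, dist_circle_eq_norm_sub, hfactor, norm_mul, Circle.norm_coe, one_mul]
  exact Real.norm_exp_I_mul_ofReal_sub_one_le

theorem shrinkRadius_pos (hδ : 0 < δ) (hP : P ∈ strip) : 0 < shrinkRadius δ P :=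
  lt_min one_pos (div_pos hδ (dist_circle_exp_pos hP))

theorem shrinkRadius_mul_mem_closedBall (hδ : 0 < δ) (hP : P ∈ strip) (z : Circle) :
    (shrinkRadius δ P * z : ℂ) ∈ Metric.closedBall 0 1 := by
  rw [mem_closedBall_zero_iff, norm_mul, Circle.norm_coe, mul_one, norm_real,
    Real.norm_of_nonneg (shrinkRadius_pos hδ hP).le]
  exact min_le_left _ _

theorem dist_shrinkRadius_mul_le (hδ : 0 < δ) (hP : P ∈ strip) :
    dist (shrinkRadius δ P * Circle.exp P.1 : ℂ) (shrinkRadius δ P * Circle.exp P.2) ≤ δ := by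
  rw [dist_eq, ← mul_sub, norm_mul, norm_real, Real.norm_of_nonneg (shrinkRadius_pos hδ hP).le,
    ← dist_circle_eq_norm_sub]
  exact (le_div_iff₀ (dist_circle_exp_pos hP)).1 (min_le_right _ _)

theorem continuousOn_shrinkRadius : ContinuousOn (shrinkRadius δ) strip :=
  continuousOn_const.inf (continuousOn_const.div (by fun_prop) fun _ hP =>
    (dist_circle_exp_pos hP).ne')

theorem shrinkRadius_swapAngles : shrinkRadius δ (swapAngles P) = shrinkRadius δ P := by
  rw [shrinkRadius, shrinkRadius, swapAngles, Circle.exp_add_two_pi, dist_comm]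

theorem shrunkChord_swapAngles : shrunkChord F δ (swapAngles P) = -1 * shrunkChord F δ P := by
  rw [shrunkChord, shrunkChord, shrinkRadius_swapAngles, swapAngles, Circle.exp_add_two_pi,
    neg_one_mul, neg_sub]

theorem continuousOn_shrunkChord (hF : ContinuousOn F (Metric.closedBall 0 1)) (hδ : 0 < δ) :
    ContinuousOn (shrunkChord F δ) strip := by
  have hr : ContinuousOn (fun P => (shrinkRadius δ P : ℂ)) strip :=
    continuous_ofReal.comp_continuousOn continuousOn_shrinkRadius
  exact (hF.comp (hr.mul (by fun_prop)) fun P hP => shrinkRadius_mul_mem_closedBall hδ hP _).sub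
    (hF.comp (hr.mul (by fun_prop)) fun P hP => shrinkRadius_mul_mem_closedBall hδ hP _)

theorem shrunkChord_ne_zero (hδ : 0 < δ) (hinj : ∀ p ∈ Metric.closedBall (0 : ℂ) 1,
      ∀ q ∈ Metric.closedBall 0 1, dist q p ≤ δ → F p = F q → p = q) (hP : P ∈ strip) :
    shrunkChord F δ P ≠ 0 := fun h0 => by
  have heq := hinj _ (shrinkRadius_mul_mem_closedBall hδ hP _) _
    (shrinkRadius_mul_mem_closedBall hδ hP _) (dist_shrinkRadius_mul_le hδ hP) (sub_eq_zero.1 h0)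
  exact circle_exp_ne_of_mem_strip hP <| Circle.ext <| .symm <|
    mul_left_cancel₀ (ofReal_ne_zero.2 (shrinkRadius_pos hδ hP).ne') heq

theorem shrinkRadius_diagonal_eq_one {ε : ℝ} (hε : ε ∈ Set.Ioo 0 (2 * π)) (hεδ : ε ≤ δ) (s : ℝ) :
    shrinkRadius δ (s, s + ε) = 1 := by
  have hdist : dist (Circle.exp s) (Circle.exp (s + ε)) ≤ ε := by
    simpa only [add_sub_cancel_left, abs_of_pos hε.1] using dist_circle_exp_le s (s + ε)
  exact min_eq_left ((one_le_div (dist_circle_exp_pos (diagonal_mem_strip hε s))).2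
    (hdist.trans hεδ))

end shrunkChord

theorem eventually_hasSqrtMonodromy_chord_of_locally_injOn {γ : Circle → ℂ} {F : ℂ → ℂ}
    (hF : ContinuousOn F (Metric.closedBall 0 1))
    (hinj : ∀ z ∈ Metric.closedBall (0 : ℂ) 1,
      ∃ U ∈ 𝓝 z, Set.InjOn F (U ∩ Metric.closedBall 0 1))
    (hFγ : ∀ z : Circle, F z = γ z) :
    ∀ᶠ ε in 𝓝[>] 0, HasSqrtMonodromy (fun s => chord γ (s, s + ε)) (-1) := by
  obtain ⟨δ, hδ, hδF⟩ := exists_pos_forall_eq_of_dist_lt (isCompact_closedBall 0 1) hinj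
  filter_upwards [Ioo_mem_nhdsGT Real.two_pi_pos, Ioo_mem_nhdsGT (half_pos hδ)] with ε hε hεδ
  have hmon := hasSqrtMonodromy_diagonal (continuousOn_shrunkChord hF (half_pos hδ))
    (fun P hP => shrunkChord_ne_zero (half_pos hδ)
      (fun p hp q hq hpq => hδF p hp q hq (hpq.trans_lt (half_lt_self hδ))) hP)
    (fun P _ => shrunkChord_swapAngles) hε
  simpa only [chord, angular, shrunkChord, shrinkRadius_diagonal_eq_one hε hεδ.2.le, ofReal_one,
    one_mul, hFγ] using hmon

theorem IsGeneric.hasTransverseCrossings {γ : Circle → ℂ} (h : IsGeneric γ) :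
    HasTransverseCrossings γ := fun P hP => by
  obtain ⟨hne, heq⟩ := hP
  rw [endpoints, Sym2.map_mk, Sym2.mk_isDiag_iff] at heq
  obtain ⟨h1, h2, hind⟩ := h.transverse P.1 P.2 (by rwa [endpoints, Sym2.mk_isDiag_iff] at hne) heq
  exact ⟨h1, h2, hind⟩

theorem image_map_crossings (γ : Circle → ℂ) :
    Sym2.map γ '' crossings γ = Sym2.diag '' selfIntersections γ := by
  ext e
  constructor
  · rintro ⟨e, ⟨hne, heq⟩, rfl⟩
    induction e using Sym2.ind with | h x y
    rw [Sym2.mk_isDiag_iff] at hne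
    rw [Sym2.map_mk, Sym2.mk_isDiag_iff] at heq
    exact ⟨γ y, ⟨x, y, hne, heq, rfl⟩, by
      rw [Sym2.map_mk, heq]
      rfl⟩
  · rintro ⟨_, ⟨x, y, hne, rfl, heq⟩, rfl⟩
    refine ⟨s(x, y), ⟨by rwa [Sym2.mk_isDiag_iff], ?_⟩, ?_⟩
    · rw [Sym2.map_mk, Sym2.mk_isDiag_iff, heq]
    · rw [Sym2.map_mk, heq]
      rfl

namespace IsGeneric

variable {γ : Circle → ℂ}

theorem pair_eq_preimage (h : IsGeneric γ) {x y : Circle} (hne : x ≠ y) (heq : γ x = γ y) :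
    {x, y} = γ ⁻¹' {γ x} := by
  have hcard := h.double _ ⟨x, y, hne, rfl, heq.symm⟩
  refine Set.eq_of_subset_of_ncard_le ?_ ?_ (Set.finite_of_ncard_ne_zero (by rw [hcard]; norm_num))
  · rintro z (rfl | rfl)
    exacts [rfl, heq.symm]
  · rw [hcard, Set.ncard_pair hne]

theorem injOn_map_crossings (h : IsGeneric γ) : Set.InjOn (Sym2.map γ) (crossings γ) := by
  intro e he f hf hef
  induction e using Sym2.ind with | h x y
  induction f using Sym2.ind with | h z w
  obtain ⟨hxy, hγxy⟩ := he
  obtain ⟨hzw, hγzw⟩ := hf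
  rw [Sym2.mk_isDiag_iff] at hxy hzw
  rw [Sym2.map_mk, Sym2.mk_isDiag_iff] at hγxy hγzw
  have hxz : γ x = γ z := by
    rw [Sym2.map_mk, Sym2.map_mk, hγxy, hγzw, Sym2.eq_iff, or_self] at hef
    rw [hγxy, hef.1, hγzw]
  refine SetLike.coe_injective ?_
  rw [Sym2.coe_mk, Sym2.coe_mk, h.pair_eq_preimage hxy hγxy, h.pair_eq_preimage hzw hγzw, hxz]

theorem finite_crossings (h : IsGeneric γ) : (crossings γ).Finite :=
  .of_finite_image (by rw [image_map_crossings]; exact h.finite.image _) h.injOn_map_crossings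

theorem ncard_crossings (h : IsGeneric γ) : (crossings γ).ncard = (selfIntersections γ).ncard := by
  rw [← h.injOn_map_crossings.ncard_image, image_map_crossings,
    Set.ncard_image_of_injective _ Sym2.diag_injective]

end IsGeneric

end SelfOverlapping

theorem mainTheorem7_general {γ : Circle → ℂ} {F : ℂ → ℂ}
    (hF : ContinuousOn F (Metric.closedBall 0 1))
    (hinj : ∀ z ∈ Metric.closedBall (0 : ℂ) 1,
      ∃ U ∈ nhds z, Set.InjOn F (U ∩ Metric.closedBall 0 1))
    (hFγ : ∀ z : Circle, F z = γ z) (hfin : (SelfOverlapping.crossings γ).Finite)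
    (htr : SelfOverlapping.HasTransverseCrossings γ) :
    Even (SelfOverlapping.crossings γ).ncard := by
  have hγ : Continuous γ := (hF.comp_continuous continuous_subtype_val fun z =>
    Metric.sphere_subset_closedBall z.2).congr hFγ
  obtain ⟨ε, hodd, hcross⟩ :=
    ((SelfOverlapping.eventually_hasSqrtMonodromy_chord_of_locally_injOn hF hinj hFγ).and
      (SelfOverlapping.eventually_hasSqrtMonodromy_chord_of_hasTransverseCrossings
        hγ hfin htr)).exists
  have hpow : (-1 : ℂ) ^ ((SelfOverlapping.crossings γ).ncard + 1) = -1 := hcross.unique hodd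
  rw [neg_one_pow_eq_neg_one_iff_odd (by norm_num), Nat.odd_add_one, Nat.not_odd_iff_even] at hpow
  exact hpow

theorem mainTheorem7 (γ : Circle → ℂ) (hreg : SelfOverlapping.IsPiecewiseRegular γ)
    (hgen : SelfOverlapping.IsGeneric γ) (hso : SelfOverlapping.IsSelfOverlapping γ) :
    Even (SelfOverlapping.selfIntersections γ).ncard := by
  obtain ⟨F, hF, hFγ⟩ := hso
  rw [← hgen.ncard_crossings]
  exact mainTheorem7_general hF.continuousOn hF.locally_injOn hFγ hgen.finite_crossings
    hgen.hasTransverseCrossings
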